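/- Let $d\ge 0$ be an integer, $m\in\mathbb R^d$, and let $\Sigma\in\mathbb R^{d\times d}$ be symmetric positive definite. Let $\pi=\mathcal N(m,\Sigma)$ and $\widehat\pi(u)=\exp(-\tfrac12\|u-m\|_\Sigma^2)$, where $\|v\|_A:=\sqrt{v^TA^{-1}v}$ for positive definite $A$. For a probability measure $\rho$ on $\mathbb R^d$ and a weight function $w$, write $$\mu[\rho,w]=\frac{\int v\,w(v)\,\mathrm d\rho(v)}{\int w\,\mathrm d\rho},\qquad \mathcal C[\rho,w]=\frac{\int (v-\mu[\rho,w])\otimes(v-\mu[\rho,w])\,w(v)\,\mathrm d\rho(v)}{\int w\,\mathrm d\rho}.$$ Let $\mathcal C(\rho)=\mathcal C[\rho,1]$ be the covariance, $\mathcal C_\alpha(\rho)=\mathcal C[\rho,\widehat\pi^\alpha]$, and, with $w_{a,A}(v;u)=\exp(-\tfrac12\|v-u\|_A^2)\,\widehat\pi(v)^a$, let $\mu_{a,A}(\rho;u)=\mu[\rho,w_{a,A}(\cdot;u)]$ and $\mathcal C_{a,A}(\rho;u)=\mathcal C[\rho,w_{a,A}(\cdot;u)]$. Localized consensus-based sampling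 (CBS) with parameters $\kappa,\beta,\gamma>0$ and preconditioner $\mathbf C(\rho;u)$ is the McKean--Vlasov Itô equation $$\mathrm dU_t=\Bigl[-\frac\gamma\kappa\bigl(U_t-\mu_{\beta,\kappa\mathbf C(\rho_t;U_t)/\beta}(\rho_t;U_t)\bigr)+\nabla_u\cdot\mathbf C(\rho_t;U_t)\Bigr]\mathrm dt+\sqrt{2\mathbf C(\rho_t;U_t)}\,\mathrm dW_t,\qquad \rho_t=\mathrm{Law}(U_t),$$ with Fokker--Planck equation $$\partial_t\rho_t(u)=\nabla\cdot\Bigl(\frac\gamma\kappa\rho_t(u)\bigl(u-\mu_{\beta,\kappa\mathbf C(\rho_t;u)/\beta}(\rho_t;u)\bigr)+\mathbf C(\rho_t;u)\nabla\rho_t(u)\Bigr).$$ A probability measure is called a stationary distribution of localized CBS if the curve $\rho_t$ constantly equal to it solves this Fokker--Planck equation, both classically (for its density) and weakly (tested against smooth compactly supported functions, through the generator of the Itô equation), with a positive definite preconditioner and all coefficients well defined. For all $\kappa,\beta>0$, $\pi$ is a stationary distribution of localized CBS in each of the following cases: 1. $\mathbf C(\rho;u)=\mathcal C(\rho)$ and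 $\gamma=\kappa+\dfrac{\beta}{\beta+1}$; 2. $\mathbf C(\rho;u)=\mathcal C_\alpha(\rho)$ with $\alpha\ge0$, and $\gamma=\dfrac{\kappa}{\alpha+1}+\dfrac{\beta}{\beta+1}$; 3. $\mathbf C(\rho;u)=\mathcal C_{\alpha,\lambda\mathcal C(\rho)}(\rho;u)$ with $\alpha\ge0$, $\lambda>0$, and $\gamma=\dfrac{\kappa}{1/\lambda+\alpha+1}+\dfrac{\beta}{\beta+1}$. -/

import Mathlib

open MeasureTheory ProbabilityTheory
open scoped ContDiff MatrixOrder Matrix.Norms.L2Operator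

noncomputable section

namespace LCBS

variable {d : ℕ}

/-- The state space `ℝ^d` with its Euclidean structure. -/
abbrev Space (d : ℕ) : Type := EuclideanSpace ℝ (Fin d)

/-- The action of a matrix on a vector of `ℝ^d`. -/
def act (A : Matrix (Fin d) (Fin d) ℝ) (v : Space d) : Space d :=
  WithLp.toLp 2 (Matrix.mulVec A v.ofLp)

/-- The weighted norm `‖v‖_A = √(vᵀ A⁻¹ v)`. -/
def wnorm (A : Matrix (Fin d) (Fin d) ℝ) (v : Space d) : ℝ :=
  Real.sqrt (v.ofLp ⬝ᵥ Matrix.mulVec A⁻¹ v.ofLp)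

/-! ### Means and covariances -/

/-- The mean `μ(ρ)`. -/
def mean (ρ : Measure (Space d)) : Space d := ∫ v, v ∂ρ

/-- The covariance `𝒞(ρ)`. -/
def cov (ρ : Measure (Space d)) : Matrix (Fin d) (Fin d) ℝ :=
  Matrix.of fun i j => ∫ v, (v i - mean ρ i) * (v j - mean ρ j) ∂ρ

/-- The mean of `ρ` reweighted by a weight function `w`. -/
def wmean (w : Space d → ℝ) (ρ : Measure (Space d)) : Space d :=
  (∫ v, w v ∂ρ)⁻¹ • ∫ v, w v • v ∂ρ

/-- The covariance of `ρ` reweighted by a weight function `w`. -/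
def wcov (w : Space d → ℝ) (ρ : Measure (Space d)) : Matrix (Fin d) (Fin d) ℝ :=
  Matrix.of fun i j =>
    (∫ v, (v i - wmean w ρ i) * (v j - wmean w ρ j) * w v ∂ρ) / ∫ v, w v ∂ρ

/-- The global weight `w_a(v) = π̂(v)^a`, for an unnormalized target density `π̂`. -/
def weight (pihat : Space d → ℝ) (a : ℝ) (v : Space d) : ℝ := pihat v ^ a

/-- The localized weight `w_{a,A}(v; u) = exp(-‖v - u‖_A² / 2) π̂(v)^a`. -/
def locWeight (pihat : Space d → ℝ) (a : ℝ) (A : Matrix (Fin d) (Fin d) ℝ)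
    (u v : Space d) : ℝ :=
  Real.exp (-(wnorm A (v - u)) ^ 2 / 2) * pihat v ^ a

/-- The localized weighted mean `μ_{a,A}(ρ; u)`. -/
def locMean (pihat : Space d → ℝ) (a : ℝ) (A : Matrix (Fin d) (Fin d) ℝ)
    (ρ : Measure (Space d)) (u : Space d) : Space d :=
  wmean (locWeight pihat a A u) ρ

/-- The localized weighted covariance `𝒞_{a,A}(ρ; u)`. -/
def locCov (pihat : Space d → ℝ) (a : ℝ) (A : Matrix (Fin d) (Fin d) ℝ)
    (ρ : Measure (Space d)) (u : Space d) : Matrix (Fin d) (Fin d) ℝ :=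
  wcov (locWeight pihat a A u) ρ

/-! ### Preconditioners -/

/-- A preconditioner `𝐂(ρ; u)`. -/
abbrev Precond (d : ℕ) : Type :=
  Measure (Space d) → Space d → Matrix (Fin d) (Fin d) ℝ

/-- The preconditioner `𝒞(ρ)`. -/
def precCov : Precond d := fun ρ _ => cov ρ

/-- The preconditioner `𝒞_α(ρ)`. -/
def precWeighted (pihat : Space d → ℝ) (α : ℝ) : Precond d :=
  fun ρ _ => wcov (weight pihat α) ρ

/-- The preconditioner `𝒞_{α, λ 𝒞(ρ)}(ρ; u)`. -/
def precLocal (pihat : Space d → ℝ) (α lam : ℝ) : Precond d :=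
  fun ρ u => locCov pihat α (lam • cov ρ) ρ u

/-! ### Differential operators -/

/-- The partial derivative in the `i`-th coordinate direction. -/
def pderiv (i : Fin d) (f : Space d → ℝ) (u : Space d) : ℝ :=
  fderiv ℝ f u (EuclideanSpace.single i 1)

/-- The divergence of a vector field. -/
def vdiv (F : Space d → Space d) (u : Space d) : ℝ :=
  ∑ i, pderiv i (fun x => F x i) u

/-- The divergence of a matrix field, taken row by row. -/
def mdiv (C : Space d → Matrix (Fin d) (Fin d) ℝ) (u : Space d) : Space d :=
  WithLp.toLp 2 fun i => ∑ j, pderiv j (fun x => C x i j) u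

/-! ### Localized consensus-based sampling

The McKean--Vlasov equation `dU = b(ρ_t, U) dt + σ(ρ_t, U) dW`, where `ρ_t` is the law of `U_t`,
`b(ρ, u) = -(γ/κ) (u - μ_{β, κ𝐂(ρ;u)/β}(ρ; u)) + ∇_u · 𝐂(ρ; u)` and `σ(ρ, u) = √(2 𝐂(ρ; u))`. -/

/-- The weighted mean `μ_{β, κ𝐂(ρ;u)/β}(ρ; u)` that attracts a particle at `u`. -/
def attractor (pihat : Space d → ℝ) (C : Precond d) (κ β : ℝ)
    (ρ : Measure (Space d)) (u : Space d) : Space d :=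
  locMean pihat β ((κ / β) • C ρ u) ρ u

/-- The drift coefficient. -/
def drift (pihat : Space d → ℝ) (C : Precond d) (κ β γ : ℝ)
    (ρ : Measure (Space d)) (u : Space d) : Space d :=
  -((γ / κ) • (u - attractor pihat C κ β ρ u)) + mdiv (C ρ) u

/-- The diffusion coefficient, a positive semidefinite square root. -/
def diffusion (C : Precond d) (ρ : Measure (Space d)) (u : Space d) :
    Matrix (Fin d) (Fin d) ℝ :=
  CFC.sqrt ((2 : ℝ) • C ρ u)

/-- The generator `L_ρ φ = b · ∇φ + ½ (σ σᵀ) : ∇²φ` of the dynamics frozen at the law `ρ`. -/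
def generator (pihat : Space d → ℝ) (C : Precond d) (κ β γ : ℝ)
    (ρ : Measure (Space d)) (φ : Space d → ℝ) (u : Space d) : ℝ :=
  ∑ i, drift pihat C κ β γ ρ u i * pderiv i φ u +
    (1 / 2) * ∑ i, ∑ j,
      (diffusion C ρ u * (diffusion C ρ u).transpose) i j * pderiv i (pderiv j φ) u

/-- The flux in the Fokker--Planck equation `∂_t ρ = ∇ · flux`, for a density `p`. The law with
density `p` is passed separately as `ρ`. -/
def flux (pihat : Space d → ℝ) (C : Precond d) (κ β γ : ℝ)
    (ρ : Measure (Space d)) (p : Space d → ℝ) (u : Space d) : Space d :=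
  ((γ / κ) * p u) • (u - attractor pihat C κ β ρ u) + act (C ρ u) (gradient p u)

/-- The coefficients of the dynamics make sense at the law `ρ`: the preconditioner is positive
definite and differentiable in space, and the integrals in the weighted mean exist, with a
positive normalization. -/
structure WellDefined (pihat : Space d → ℝ) (C : Precond d) (κ β : ℝ)
    (ρ : Measure (Space d)) : Prop where
  posDef : ∀ u, (C ρ u).PosDef
  differentiable : ∀ i j, Differentiable ℝ fun u => C ρ u i j
  integrable_weight : ∀ u, Integrable (locWeight pihat β ((κ / β) • C ρ u) u) ρ
  weight_pos : ∀ u, 0 < ∫ v, locWeight pihat β ((κ / β) • C ρ u) u v ∂ρ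
  integrable_smul : ∀ u,
    Integrable (fun v => locWeight pihat β ((κ / β) • C ρ u) u v • v) ρ

/-- The law with density `p` with respect to Lebesgue measure. -/
def lawOf (p : Space d → ℝ) : Measure (Space d) :=
  volume.withDensity fun u => ENNReal.ofReal (p u)

/-- Weak (measure-valued) evolution of the laws of the McKean--Vlasov dynamics on `[0, ∞)`. -/
structure IsWeakSolution (pihat : Space d → ℝ) (C : Precond d) (κ β γ : ℝ)
    (ρ : ℝ → Measure (Space d)) : Prop where
  prob : ∀ t, 0 ≤ t → IsProbabilityMeasure (ρ t)
  wellDefined : ∀ t, 0 ≤ t → WellDefined pihat C κ β (ρ t)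
  integrable : ∀ φ : Space d → ℝ, ContDiff ℝ ∞ φ → HasCompactSupport φ → ∀ t, 0 ≤ t →
    Integrable (generator pihat C κ β γ (ρ t) φ) (ρ t)
  intervalIntegrable : ∀ φ : Space d → ℝ, ContDiff ℝ ∞ φ → HasCompactSupport φ → ∀ t, 0 ≤ t →
    IntervalIntegrable (fun s => ∫ u, generator pihat C κ β γ (ρ s) φ u ∂(ρ s)) volume 0 t
  evolution : ∀ φ : Space d → ℝ, ContDiff ℝ ∞ φ → HasCompactSupport φ → ∀ t, 0 ≤ t →
    ∫ u, φ u ∂(ρ t) = ∫ u, φ u ∂(ρ 0) +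
      ∫ s in (0 : ℝ)..t, ∫ u, generator pihat C κ β γ (ρ s) φ u ∂(ρ s)

/-- Classical solution, by densities `p t`, of the Fokker--Planck equation on `[0, ∞)`. -/
structure IsClassicalSolution (pihat : Space d → ℝ) (C : Precond d) (κ β γ : ℝ)
    (p : ℝ → Space d → ℝ) : Prop where
  nonneg : ∀ t, 0 ≤ t → ∀ u, 0 ≤ p t u
  prob : ∀ t, 0 ≤ t → IsProbabilityMeasure (lawOf (p t))
  wellDefined : ∀ t, 0 ≤ t → WellDefined pihat C κ β (lawOf (p t))
  differentiable : ∀ t, 0 ≤ t → Differentiable ℝ (p t)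
  differentiable_flux : ∀ t, 0 ≤ t →
    Differentiable ℝ (flux pihat C κ β γ (lawOf (p t)) (p t))
  evolution : ∀ t, 0 ≤ t → ∀ u, HasDerivWithinAt (fun s => p s u)
    (vdiv (flux pihat C κ β γ (lawOf (p t)) (p t)) u) (Set.Ici 0) t

/-- `ρ` is a stationary distribution of localized consensus-based sampling: the constant curve
`ρ_t = ρ` is an evolution of laws of the dynamics, both weakly and, for a density of `ρ`, as a
classical solution of the Fokker--Planck equation. -/
structure IsStationary (pihat : Space d → ℝ) (C : Precond d) (κ β γ : ℝ)
    (ρ : Measure (Space d)) : Prop where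
  weak : IsWeakSolution pihat C κ β γ fun _ => ρ
  classical : ∃ p : Space d → ℝ, ρ = lawOf p ∧ IsClassicalSolution pihat C κ β γ fun _ => p

/-- The unnormalized Gaussian density `exp(-½ ‖u - m‖_Σ²)`. -/
def gaussHat (m : Space d) (S : Matrix (Fin d) (Fin d) ℝ) (u : Space d) : ℝ :=
  Real.exp (-(1 / 2) * wnorm S (u - m) ^ 2)

end LCBS

end

namespace LCBS

variable {d : ℕ}

/-! ### Gaussian weights as exponentials of quadratic forms -/

/-! At the Gaussian law every weighted average becomes an average against another Gaussian. A weight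
`w_{a,A}` with `A` a multiple of `S`, times the density of the target, is a constant times a
Gaussian density whose covariance is a multiple of `S` (`locWeight_mul_gaussHat`, by completing the
square). Hence all three preconditioners equal a constant matrix `c • S`, with `c` equal to `1`, `(α
+ 1)⁻¹` or `(lam⁻¹ + α + 1)⁻¹`, and the attractor is an explicit point on the line through `m` and
`u`.

The value `γ = κ * c + β / (β + 1)` is the one that turns the attraction term into `c • (u - m)`
(`attractor_of_precond_eq`). The frozen dynamics is then an Ornstein-Uhlenbeck process run at speed
`c`. Its Fokker-Planck flux vanishes identically at the Gaussian, which gives the classical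
statement; its generator integrates to zero by Gaussian integration by parts, which gives the weak
one. Both are assembled in `isStationary_of_precond_eq`. -/

lemma inner_act_comm {A : Matrix (Fin d) (Fin d) ℝ} (hA : A.IsHermitian) (x y : Space d) :
    inner ℝ x (act A y) = inner ℝ y (act A x) := by
  have hT : A.transpose = A := by simpa [Matrix.IsHermitian] using hA
  change inner ℝ x (Matrix.toEuclideanCLM (𝕜 := ℝ) A y) =
    inner ℝ y (Matrix.toEuclideanCLM (𝕜 := ℝ) A x)
  rw [Matrix.inner_toEuclideanCLM, Matrix.inner_toEuclideanCLM, Matrix.dotProduct_mulVec,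
    ← Matrix.mulVec_transpose, hT, dotProduct_comm]

lemma wnorm_sq {A : Matrix (Fin d) (Fin d) ℝ} (hA : A.PosDef) (v : Space d) :
    wnorm A v ^ 2 = inner ℝ v (act A⁻¹ v) := by
  have h := hA.inv.posSemidef.dotProduct_mulVec_nonneg v.ofLp
  rw [star_trivial] at h
  rw [wnorm, Real.sq_sqrt h]
  exact (Matrix.inner_toEuclideanCLM A⁻¹ v v).symm

lemma act_add (A : Matrix (Fin d) (Fin d) ℝ) (x y : Space d) :
    act A (x + y) = act A x + act A y :=
  map_add (Matrix.toEuclideanCLM (𝕜 := ℝ) A) x y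

lemma act_smul (A : Matrix (Fin d) (Fin d) ℝ) (c : ℝ) (x : Space d) :
    act A (c • x) = c • act A x :=
  map_smul (Matrix.toEuclideanCLM (𝕜 := ℝ) A) c x

lemma act_act (A B : Matrix (Fin d) (Fin d) ℝ) (x : Space d) :
    act A (act B x) = act (A * B) x := by
  simp [act, Matrix.mulVec_mulVec]

lemma act_one (x : Space d) : act 1 x = x := by simp [act]

lemma smul_act (c : ℝ) (A : Matrix (Fin d) (Fin d) ℝ) (x : Space d) :
    act (c • A) x = c • act A x := by
  simp [act, Matrix.smul_mulVec]

lemma continuous_act (A : Matrix (Fin d) (Fin d) ℝ) : Continuous (act A) :=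
  (Matrix.toEuclideanCLM (𝕜 := ℝ) A).continuous

lemma inv_smul_of_pos {c : ℝ} (hc : 0 < c) {A : Matrix (Fin d) (Fin d) ℝ} (hA : A.PosDef) :
    (c • A)⁻¹ = c⁻¹ • A⁻¹ := by
  have hu : IsUnit A.det := hA.det_pos.ne'.isUnit
  apply Matrix.inv_eq_left_inv
  simp [smul_smul, Matrix.nonsing_inv_mul A hu, hc.ne']

lemma wnorm_smul_sq {c : ℝ} (hc : 0 < c) {A : Matrix (Fin d) (Fin d) ℝ} (hA : A.PosDef)
    (v : Space d) : wnorm (c • A) v ^ 2 = c⁻¹ * wnorm A v ^ 2 := by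
  rw [wnorm_sq (hA.smul hc), wnorm_sq hA, inv_smul_of_pos hc hA, smul_act, inner_smul_right]

lemma gaussHat_pos (m : Space d) (S : Matrix (Fin d) (Fin d) ℝ) (u : Space d) :
    0 < gaussHat m S u := Real.exp_pos _

lemma gaussHat_eq {S : Matrix (Fin d) (Fin d) ℝ} (hS : S.PosDef) (m u : Space d) :
    gaussHat m S u = Real.exp (-(1 / 2) * inner ℝ (u - m) (act S⁻¹ (u - m))) := by
  rw [gaussHat, wnorm_sq hS]

lemma continuous_gaussHat {S : Matrix (Fin d) (Fin d) ℝ} (hS : S.PosDef) (m : Space d) :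
    Continuous (gaussHat m S) := by
  have h : gaussHat m S = fun u =>
      Real.exp (-(1 / 2) * inner ℝ (u - m) (act S⁻¹ (u - m))) := funext (gaussHat_eq hS m)
  have := continuous_act S⁻¹
  rw [h]
  fun_prop

lemma hasGradientAt_gaussHat {S : Matrix (Fin d) (Fin d) ℝ} (hS : S.PosDef) (m u : Space d) :
    HasGradientAt (gaussHat m S) (-(gaussHat m S u) • act S⁻¹ (u - m)) u := by
  have h1 : HasFDerivAt (fun x : Space d => x - m) (ContinuousLinearMap.id ℝ _) u :=
    (hasFDerivAt_id u).sub_const m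
  have h2 : HasFDerivAt (fun x : Space d => act S⁻¹ (x - m))
      (Matrix.toEuclideanCLM (𝕜 := ℝ) S⁻¹) u := by
    have h := (Matrix.toEuclideanCLM (𝕜 := ℝ) S⁻¹).hasFDerivAt (x := u - m)
    exact (h.comp u h1).congr_fderiv (ContinuousLinearMap.comp_id _)
  have h3 := ((h1.inner ℝ h2).const_mul (-(1 / 2))).exp
  rw [hasGradientAt_iff_hasFDerivAt]
  refine (h3.congr_of_eventuallyEq (.of_forall (gaussHat_eq hS m))).congr_fderiv ?_
  ext v
  have hc : inner ℝ (u - m) ((Matrix.toEuclideanCLM (𝕜 := ℝ) S⁻¹) v) =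
      inner ℝ v (act S⁻¹ (u - m)) := inner_act_comm hS.inv.isHermitian (u - m) v
  rw [← gaussHat_eq hS]
  simp only [smul_apply, ContinuousLinearMap.comp_apply,
    ContinuousLinearMap.prod_apply, ContinuousLinearMap.id_apply, fderivInnerCLM_apply, hc,
    InnerProductSpace.toDual_apply_apply, real_inner_comm v, inner_smul_right, smul_eq_mul]
  ring

/-! ### The density of the multivariate Gaussian measure -/

lemma map_withDensity_comp {X Y : Type*} [MeasurableSpace X] [MeasurableSpace Y]
    (μ : Measure X) {f : X → Y} (hf : Measurable f) {g : Y → ENNReal} (hg : Measurable g) :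
    (μ.withDensity (g ∘ f)).map f = (μ.map f).withDensity g := by
  ext s hs
  rw [Measure.map_apply hf hs, withDensity_apply _ (hf hs), withDensity_apply _ hs,
    setLIntegral_map hs hg hf]
  rfl

/-- Finite measures with equal characteristic functions coincide, and the Fourier transform of the
Gaussian density is known. The normalization is left implicit because later only its positivity
matters. -/
lemma stdGaussian_eq_lawOf :
    ∃ Z : ℝ, 0 < Z ∧
      stdGaussian (Space d) = lawOf fun x => Z * Real.exp (-(1 / 2) * ‖x‖ ^ 2) := by
  set I : ℝ := ∫ x : Space d, Real.exp (-(1 / 2) * ‖x‖ ^ 2) with hI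
  have hIval : I = (Real.pi / (1 / 2)) ^ (Module.finrank ℝ (Space d) / 2 : ℝ) :=
    GaussianFourier.integral_rexp_neg_mul_sq_norm (V := Space d) (b := 1 / 2) (by norm_num)
  have hIpos : 0 < I := by rw [hIval]; positivity
  have hint : Integrable fun x : Space d => Real.exp (-(1 / 2) * ‖x‖ ^ 2) := by
    -- A non-integrable function has integral `0` by convention, so positivity of `I` already forces
    -- integrability.
    by_contra h
    exact hIpos.ne' (integral_undef h)
  refine ⟨I⁻¹, inv_pos.2 hIpos, ?_⟩
  have hmeas : Measurable fun x : Space d =>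
      ENNReal.ofReal (I⁻¹ * Real.exp (-(1 / 2) * ‖x‖ ^ 2)) := by fun_prop
  have : IsFiniteMeasure (lawOf fun x : Space d => I⁻¹ * Real.exp (-(1 / 2) * ‖x‖ ^ 2)) :=
    isFiniteMeasure_withDensity_ofReal (hint.const_mul _).2
  apply Measure.ext_of_charFun
  ext t
  rw [charFun_stdGaussian, charFun_apply, lawOf,
    integral_withDensity_eq_integral_toReal_smul hmeas (by simp)]
  have key := GaussianFourier.integral_cexp_neg_mul_sq_norm_add (V := Space d)
    (b := (1 / 2 : ℂ)) (by norm_num) Complex.I t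
  have hIC : (I : ℂ) = (Real.pi / (1 / 2 : ℂ)) ^ (Module.finrank ℝ (Space d) / 2 : ℂ) := by
    rw [hIval, Complex.ofReal_cpow (by positivity)]
    push_cast
    rfl
  have hpt : ∀ x : Space d,
      (ENNReal.ofReal (I⁻¹ * Real.exp (-(1 / 2) * ‖x‖ ^ 2))).toReal •
        Complex.exp (inner ℝ x t * Complex.I) =
      (I : ℂ)⁻¹ * Complex.exp (-(1 / 2 : ℂ) * ‖x‖ ^ 2 + Complex.I * inner ℝ t x) := by
    intro x
    rw [ENNReal.toReal_ofReal (by positivity), Complex.exp_add, real_inner_comm,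
      Complex.real_smul, mul_comm Complex.I]
    push_cast
    ring
  simp_rw [hpt]
  rw [integral_const_mul, key, ← hIC, ← mul_assoc,
    inv_mul_cancel₀ (Complex.ofReal_ne_zero.2 hIpos.ne'), one_mul, Complex.I_sq]
  congr 1
  ring

/-- The measure is the image of the standard Gaussian under `x ↦ m + √S x`. Since `√S S⁻¹ √S = 1`,
this map pulls the quadratic form of `S⁻¹` back to `‖x‖ ^ 2`, and the Jacobian only changes the
constant. -/
lemma multivariateGaussian_eq_lawOf (m : Space d) {S : Matrix (Fin d) (Fin d) ℝ}
    (hS : S.PosDef) :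
    ∃ Z : ℝ, 0 < Z ∧ multivariateGaussian m S = lawOf fun u => Z * gaussHat m S u := by
  obtain ⟨Z, hZ, hstd⟩ := stdGaussian_eq_lawOf (d := d)
  set R := CFC.sqrt S with hR
  have hRR : R * R = S := CFC.sqrt_mul_sqrt_self S hS.posSemidef.nonneg
  have hRh : R.IsHermitian := (CFC.sqrt_nonneg S).isSelfAdjoint
  have hdet : R.det * R.det = S.det := by rw [← Matrix.det_mul, hRR]
  have hdet0 : R.det ≠ 0 := fun h => hS.det_pos.ne' (by rw [← hdet, h, zero_mul])
  have hRu : IsUnit R.det := hdet0.isUnit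
  set L := Matrix.toEuclideanCLM (𝕜 := ℝ) R with hL
  have hLdet : LinearMap.det (L : Space d →ₗ[ℝ] Space d) = R.det := by
    rw [hL, Matrix.coe_toEuclideanCLM_eq_toEuclideanLin]
    exact LinearMap.det_toLin (PiLp.basisFun 2 ℝ (Fin d)) R
  have hmap : (volume : Measure (Space d)).map (fun x => m + L x) =
      ENNReal.ofReal |R.det⁻¹| • volume := by
    have h := Measure.map_linearMap_addHaar_eq_smul_addHaar (volume : Measure (Space d))
      (f := (L : Space d →ₗ[ℝ] Space d)) (by rwa [hLdet])
    have hc : (fun x => m + L x) = (fun y => m + y) ∘ L := rfl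
    rw [hc, ← Measure.map_map (by fun_prop) (by fun_prop)]
    have h' : (volume : Measure (Space d)).map L = ENNReal.ofReal |R.det⁻¹| • volume := by
      rw [← hLdet]; exact h
    rw [h', Measure.map_smul, map_add_left_eq_self]
  have hgm : Measurable fun u => ENNReal.ofReal (Z * gaussHat m S u) := by
    have := (continuous_gaussHat hS m).measurable
    fun_prop
  have hpull : (fun x : Space d => ENNReal.ofReal (Z * Real.exp (-(1 / 2) * ‖x‖ ^ 2))) =
      (fun u => ENNReal.ofReal (Z * gaussHat m S u)) ∘ fun x => m + L x := by
    ext x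
    have h1 : act R (act S⁻¹ (act R x)) = x := by
      rw [act_act, act_act, ← hRR, Matrix.mul_inv_rev, Matrix.mul_assoc, Matrix.mul_assoc,
        Matrix.nonsing_inv_mul R hRu, Matrix.mul_one, Matrix.mul_nonsing_inv R hRu, act_one]
    have h2 : inner ℝ (act R x) (act S⁻¹ (act R x)) = ‖x‖ ^ 2 := by
      rw [real_inner_comm, inner_act_comm hRh, h1, real_inner_self_eq_norm_sq]
    have h3 : L x = act R x := rfl
    simp only [Function.comp_apply, gaussHat_eq hS, add_sub_cancel_left, h3, h2]
  refine ⟨|R.det⁻¹| * Z, by positivity, ?_⟩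
  rw [multivariateGaussian, hstd, lawOf, hpull, map_withDensity_comp _ (by fun_prop) hgm, hmap,
    withDensity_smul_measure, lawOf, ← withDensity_smul _ hgm]
  congr 1
  ext u
  simp only [Pi.smul_apply, smul_eq_mul]
  rw [← ENNReal.ofReal_mul (abs_nonneg _), mul_assoc]

/-! ### Reweighted Gaussian measures -/

section Reweighting

variable {E : Type} [NormedAddCommGroup E] [NormedSpace ℝ E]

lemma integral_lawOf {p : Space d → ℝ} (hp : Measurable p) (h0 : ∀ u, 0 ≤ p u)
    (f : Space d → E) : ∫ u, f u ∂(lawOf p) = ∫ u, p u • f u := by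
  rw [lawOf, integral_withDensity_eq_integral_toReal_smul (by fun_prop) (by simp)]
  simp_rw [ENNReal.toReal_ofReal (h0 _)]

lemma integrable_lawOf {p : Space d → ℝ} (hp : Measurable p) (h0 : ∀ u, 0 ≤ p u)
    {f : Space d → E} : Integrable f (lawOf p) ↔ Integrable fun u => p u • f u := by
  rw [lawOf, integrable_withDensity_iff_integrable_smul' (by fun_prop) (by simp)]
  simp_rw [ENNReal.toReal_ofReal (h0 _)]

end Reweighting

/-- A single factor `k` serves every integrand and every target space. It therefore cancels in the
quotients defining weighted means and covariances, where `f` is `1`, `v`, or a product of centred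
coordinates. -/
lemma exists_integral_reweight {m n : Space d} {S T : Matrix (Fin d) (Fin d) ℝ}
    (hS : S.PosDef) (hT : T.PosDef) {w : Space d → ℝ} {K : ℝ} (hK : 0 < K)
    (hw : ∀ v, w v * gaussHat m S v = K * gaussHat n T v) :
    ∃ k : ℝ, 0 < k ∧ ∀ (E : Type) [NormedAddCommGroup E] [NormedSpace ℝ E] (f : Space d → E),
      (∫ v, w v • f v ∂(multivariateGaussian m S) =
        k • ∫ v, f v ∂(multivariateGaussian n T)) ∧
      (Integrable f (multivariateGaussian n T) →
        Integrable (fun v => w v • f v) (multivariateGaussian m S)) := by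
  obtain ⟨Z, hZ, hmS⟩ := multivariateGaussian_eq_lawOf m hS
  obtain ⟨Y, hY, hnT⟩ := multivariateGaussian_eq_lawOf n hT
  have hp : Measurable fun u => Z * gaussHat m S u :=
    ((continuous_gaussHat hS m).const_mul Z).measurable
  have hq : Measurable fun u => Y * gaussHat n T u :=
    ((continuous_gaussHat hT n).const_mul Y).measurable
  have hp0 : ∀ u, 0 ≤ Z * gaussHat m S u := fun u => (mul_pos hZ (gaussHat_pos m S u)).le
  have hq0 : ∀ u, 0 ≤ Y * gaussHat n T u := fun u => (mul_pos hY (gaussHat_pos n T u)).le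
  refine ⟨Z * K / Y, by positivity, fun E _ _ f => ?_⟩
  have hpt : (fun v => (Z * gaussHat m S v) • w v • f v) =
      fun v => (Z * K / Y) • (Y * gaussHat n T v) • f v := by
    ext v
    rw [smul_smul, smul_smul]
    congr 1
    rw [mul_assoc, mul_comm (gaussHat m S v), hw]
    field_simp
  rw [hmS, hnT, integral_lawOf hp hp0, integral_lawOf hq hq0, integrable_lawOf hp hp0,
    integrable_lawOf hq hq0, hpt, integral_smul]
  exact ⟨rfl, fun h => h.smul _⟩

lemma integral_weight_of_reweight {m n : Space d} {S T : Matrix (Fin d) (Fin d) ℝ}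
    (hS : S.PosDef) (hT : T.PosDef) {w : Space d → ℝ} {K : ℝ} (hK : 0 < K)
    (hw : ∀ v, w v * gaussHat m S v = K * gaussHat n T v) :
    0 < ∫ v, w v ∂(multivariateGaussian m S) ∧ Integrable w (multivariateGaussian m S) ∧
      Integrable (fun v => w v • v) (multivariateGaussian m S) := by
  obtain ⟨k, hk, h⟩ := exists_integral_reweight hS hT hK hw
  have h1 := h ℝ fun _ => 1
  simp only [smul_eq_mul, mul_one, integral_const, probReal_univ] at h1
  refine ⟨by rw [h1.1]; exact hk, h1.2 (integrable_const _), ?_⟩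
  exact (h (Space d) fun v => v).2 IsGaussian.integrable_fun_id

lemma wmean_of_reweight {m n : Space d} {S T : Matrix (Fin d) (Fin d) ℝ}
    (hS : S.PosDef) (hT : T.PosDef) {w : Space d → ℝ} {K : ℝ} (hK : 0 < K)
    (hw : ∀ v, w v * gaussHat m S v = K * gaussHat n T v) :
    wmean w (multivariateGaussian m S) = n := by
  obtain ⟨k, hk, h⟩ := exists_integral_reweight hS hT hK hw
  have h1 := (h ℝ fun _ => 1).1
  simp only [smul_eq_mul, mul_one, integral_const, probReal_univ] at h1
  rw [wmean, h1, (h (Space d) fun v => v).1, integral_id_multivariateGaussian, smul_smul,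
    inv_mul_cancel₀ hk.ne', one_smul]

lemma integral_eval_multivariateGaussian (m : Space d) (S : Matrix (Fin d) (Fin d) ℝ)
    (i : Fin d) : ∫ v, v i ∂(multivariateGaussian m S) = m i := by
  have h := (EuclideanSpace.proj (𝕜 := ℝ) i).integral_comp_comm
    (IsGaussian.integrable_fun_id (μ := multivariateGaussian m S))
  rw [integral_id_multivariateGaussian] at h
  exact h

lemma integral_sub_mul_sub_multivariateGaussian (m : Space d) {S : Matrix (Fin d) (Fin d) ℝ}
    (hS : S.PosDef) (i j : Fin d) :
    ∫ v, (v i - m i) * (v j - m j) ∂(multivariateGaussian m S) = S i j := by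
  rw [← covariance_eval_multivariateGaussian (μ := m) hS.posSemidef i j, covariance,
    integral_eval_multivariateGaussian, integral_eval_multivariateGaussian]

lemma cov_multivariateGaussian (m : Space d) {S : Matrix (Fin d) (Fin d) ℝ} (hS : S.PosDef) :
    cov (multivariateGaussian m S) = S := by
  ext i j
  simp only [cov, Matrix.of_apply, mean, integral_id_multivariateGaussian]
  exact integral_sub_mul_sub_multivariateGaussian m hS i j

lemma wcov_of_reweight {m n : Space d} {S T : Matrix (Fin d) (Fin d) ℝ}
    (hS : S.PosDef) (hT : T.PosDef) {w : Space d → ℝ} {K : ℝ} (hK : 0 < K)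
    (hw : ∀ v, w v * gaussHat m S v = K * gaussHat n T v) :
    wcov w (multivariateGaussian m S) = T := by
  obtain ⟨k, hk, h⟩ := exists_integral_reweight hS hT hK hw
  have h1 := (h ℝ fun _ => 1).1
  simp only [smul_eq_mul, mul_one, integral_const, probReal_univ] at h1
  ext i j
  have h2 := (h ℝ fun v => (v i - n i) * (v j - n j)).1
  simp only [smul_eq_mul, integral_sub_mul_sub_multivariateGaussian n hT] at h2
  simp only [wcov, Matrix.of_apply, wmean_of_reweight hS hT hK hw, mul_comm _ (w _), h1, h2]
  field_simp

/-! ### Global and localized Gaussian weights -/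

lemma gaussHat_rpow (m : Space d) (S : Matrix (Fin d) (Fin d) ℝ) (a : ℝ) (v : Space d) :
    gaussHat m S v ^ a = Real.exp (a * (-(1 / 2) * wnorm S (v - m) ^ 2)) := by
  rw [gaussHat, ← Real.exp_mul, mul_comm]

lemma weight_mul_gaussHat {S : Matrix (Fin d) (Fin d) ℝ} (hS : S.PosDef) (m : Space d) {a : ℝ}
    (ha : 0 ≤ a) (v : Space d) :
    weight (gaussHat m S) a v * gaussHat m S v = 1 * gaussHat m ((a + 1)⁻¹ • S) v := by
  have ha1 : 0 < a + 1 := by positivity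
  rw [weight, gaussHat_rpow, gaussHat, gaussHat, wnorm_smul_sq (inv_pos.2 ha1) hS,
    ← Real.exp_add, inv_inv, one_mul]
  congr 1
  ring

/-- Precisions add: `s⁻¹` centred at `u` and `a + 1` centred at `m`, both in units of `S⁻¹`. The new
mean is the precision-weighted average of the two centres. -/
lemma locWeight_mul_gaussHat {S : Matrix (Fin d) (Fin d) ℝ} (hS : S.PosDef) (m u : Space d)
    {a s : ℝ} (ha : 0 ≤ a) (hs : 0 < s) :
    ∃ K : ℝ, 0 < K ∧ ∀ v, locWeight (gaussHat m S) a (s • S) u v * gaussHat m S v =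
      K * gaussHat (m + (s⁻¹ / (s⁻¹ + a + 1)) • (u - m)) ((s⁻¹ + a + 1)⁻¹ • S) v := by
  set r := s⁻¹ with hr
  have hr0 : 0 < r := inv_pos.2 hs
  set t := r + a + 1 with ht
  have ht0 : 0 < t := by positivity
  set q : ℝ := inner ℝ (u - m) (act S⁻¹ (u - m)) with hq
  -- The constant is the value of the combined exponent at the new mean `n`, where `n - u = -((a +
  -- 1) / t) • (u - m)` and `n - m = (r / t) • (u - m)`.
  refine ⟨Real.exp (-(1 / 2) * ((r * ((a + 1) / t) ^ 2 + (a + 1) * (r / t) ^ 2) * q)),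
    Real.exp_pos _, fun v => ?_⟩
  set n := m + (r / t) • (u - m) with hn
  have expand : ∀ c : ℝ, wnorm S ((v - n) + c • (u - m)) ^ 2 =
      wnorm S (v - n) ^ 2 + 2 * c * inner ℝ (v - n) (act S⁻¹ (u - m)) + c ^ 2 * q := by
    intro c
    rw [wnorm_sq hS, wnorm_sq hS, act_add, act_smul, inner_add_left, inner_add_right,
      inner_add_right, inner_smul_left, inner_smul_left, inner_smul_right, inner_smul_right,
      inner_act_comm hS.inv.isHermitian (u - m) (v - n), conj_trivial]
    ring
  have hvm : v - m = (v - n) + (r / t) • (u - m) := by rw [hn]; abel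
  have hvu : v - u = (v - n) + (-((a + 1) / t)) • (u - m) := by
    have h1 : (a + 1) / t = 1 - r / t := by rw [ht]; field_simp; ring
    rw [h1, hn]
    module
  rw [locWeight, gaussHat_rpow, gaussHat, gaussHat, wnorm_smul_sq hs hS,
    wnorm_smul_sq (inv_pos.2 ht0) hS, ← Real.exp_add, ← Real.exp_add, ← Real.exp_add, inv_inv,
    ← hr, hvm, hvu, expand, expand]
  -- The cross terms cancel: `r * (-((a + 1) / t)) + (a + 1) * (r / t) = 0`.
  congr 1
  rw [ht]
  field_simp
  ring

/-! ### Gaussian integration by parts -/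

lemma contDiff_pderiv {φ : Space d → ℝ} (hφ : ContDiff ℝ ∞ φ) (i : Fin d) :
    ContDiff ℝ ∞ (pderiv i φ) :=
  (hφ.fderiv_right (m := ∞) (by simp)).clm_apply contDiff_const

lemma hasCompactSupport_pderiv {φ : Space d → ℝ} (hφ : HasCompactSupport φ) (i : Fin d) :
    HasCompactSupport (pderiv i φ) :=
  hφ.fderiv_apply ℝ _

lemma pderiv_gaussHat {S : Matrix (Fin d) (Fin d) ℝ} (hS : S.PosDef) (m : Space d) (i : Fin d)
    (u : Space d) :
    pderiv i (gaussHat m S) u = -(gaussHat m S u * act S⁻¹ (u - m) i) := by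
  have h := (hasGradientAt_gaussHat hS m u).hasFDerivAt.fderiv
  rw [pderiv, h, InnerProductSpace.toDual_apply_apply, real_inner_comm,
    EuclideanSpace.inner_single_left]
  simp

/-- Stein's identity: the logarithmic gradient of the density is `-S⁻¹ (u - m)`, and compact support
of `g` removes boundary terms. -/
lemma integral_pderiv_multivariateGaussian {S : Matrix (Fin d) (Fin d) ℝ} (hS : S.PosDef)
    (m : Space d) {g : Space d → ℝ} (hg : ContDiff ℝ ∞ g) (hgc : HasCompactSupport g)
    (i : Fin d) :
    ∫ u, pderiv i g u ∂(multivariateGaussian m S) =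
      ∫ u, act S⁻¹ (u - m) i * g u ∂(multivariateGaussian m S) := by
  obtain ⟨Z, hZ, hmS⟩ := multivariateGaussian_eq_lawOf m hS
  have hG := continuous_gaussHat hS m
  have hA := continuous_act S⁻¹
  have hp : Measurable fun u => Z * gaussHat m S u := (hG.const_mul Z).measurable
  have hp0 : ∀ u, 0 ≤ Z * gaussHat m S u := fun u => (mul_pos hZ (gaussHat_pos m S u)).le
  have hg' := (contDiff_pderiv hg i).continuous
  have hgc' := hasCompactSupport_pderiv hgc i
  have hibp := integral_mul_fderiv_eq_neg_fderiv_mul_of_integrable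
    (μ := (volume : Measure (Space d))) (f := gaussHat m S) (g := g)
    (v := EuclideanSpace.single i 1) ?_ ?_ ?_
    (fun x _ => (hasGradientAt_gaussHat hS m x).differentiableAt)
    (fun x _ => hg.differentiable (by simp) x)
  · change ∫ u, gaussHat m S u * pderiv i g u = -∫ u, pderiv i (gaussHat m S) u * g u at hibp
    rw [hmS, integral_lawOf hp hp0, integral_lawOf hp hp0]
    simp only [smul_eq_mul, mul_assoc, integral_const_mul]
    rw [hibp, ← integral_neg]
    congr 2
    ext u
    rw [pderiv_gaussHat hS]
    ring
  · change Integrable fun u => pderiv i (gaussHat m S) u * g u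
    simp only [pderiv_gaussHat hS]
    exact Continuous.integrable_of_hasCompactSupport (by fun_prop) hgc.mul_left
  · exact Continuous.integrable_of_hasCompactSupport (hG.mul hg') hgc'.mul_left
  · exact Continuous.integrable_of_hasCompactSupport (hG.mul hg.continuous) hgc.mul_left

/-- The generator of the Ornstein-Uhlenbeck process `dU = -(U - m) dt + √(2 S) dW`. -/
noncomputable def ouGenerator (m : Space d) (S : Matrix (Fin d) (Fin d) ℝ) (φ : Space d → ℝ)
    (u : Space d) : ℝ :=
  ∑ j, (∑ i, S i j * pderiv i (pderiv j φ) u - (u - m) j * pderiv j φ u)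

lemma integrable_ouGenerator (m : Space d) (S : Matrix (Fin d) (Fin d) ℝ) {φ : Space d → ℝ}
    (hφ : ContDiff ℝ ∞ φ) (hc : HasCompactSupport φ) (μ : Measure (Space d))
    [IsFiniteMeasure μ] :
    (∀ j, Integrable (fun u => (u - m) j * pderiv j φ u) μ) ∧
      (∀ i j, Integrable (fun u => S i j * pderiv i (pderiv j φ) u) μ) ∧
      Integrable (ouGenerator m S φ) μ := by
  have h1 : ∀ j, Integrable (fun u => (u - m) j * pderiv j φ u) μ := fun j => by
    have := (contDiff_pderiv hφ j).continuous
    exact Continuous.integrable_of_hasCompactSupport (by fun_prop)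
      (hasCompactSupport_pderiv hc j).mul_left
  have h2 : ∀ i j, Integrable (fun u => S i j * pderiv i (pderiv j φ) u) μ := fun i j => by
    have := (contDiff_pderiv (contDiff_pderiv hφ j) i).continuous
    exact Continuous.integrable_of_hasCompactSupport (by fun_prop)
      (hasCompactSupport_pderiv (hasCompactSupport_pderiv hc j) i).mul_left
  exact ⟨h1, h2, integrable_finsetSum _ fun j _ =>
    (integrable_finsetSum _ fun i _ => h2 i j).sub (h1 j)⟩

/-- Stein's identity applied to each `pderiv j φ` turns the second-order term into `S S⁻¹ (u - m)`
paired with the gradient, which is the drift term. -/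
lemma integral_ouGenerator_multivariateGaussian {S : Matrix (Fin d) (Fin d) ℝ} (hS : S.PosDef)
    (m : Space d) {φ : Space d → ℝ} (hφ : ContDiff ℝ ∞ φ) (hc : HasCompactSupport φ) :
    ∫ u, ouGenerator m S φ u ∂(multivariateGaussian m S) = 0 := by
  obtain ⟨h1, h2, -⟩ := integrable_ouGenerator m S hφ hc (multivariateGaussian m S)
  have hA := continuous_act S⁻¹
  have hu : IsUnit S.det := hS.det_pos.ne'.isUnit
  simp only [ouGenerator]
  have h3 : ∀ j, Integrable (fun u => ∑ i, S i j * pderiv i (pderiv j φ) u -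
      (u - m) j * pderiv j φ u) (multivariateGaussian m S) :=
    fun j => (integrable_finsetSum _ fun i _ => h2 i j).sub (h1 j)
  rw [integral_finsetSum _ fun j _ => h3 j]
  refine Finset.sum_eq_zero fun j _ => ?_
  have hgj := contDiff_pderiv hφ j
  have hgc := hasCompactSupport_pderiv hc j
  have hj := hgj.continuous
  rw [integral_sub (integrable_finsetSum _ fun i _ => h2 i j) (h1 j),
    integral_finsetSum _ fun i _ => h2 i j, sub_eq_zero]
  simp only [integral_const_mul, integral_pderiv_multivariateGaussian hS m hgj hgc]
  simp only [← integral_const_mul]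
  rw [← integral_finsetSum]
  · congr 1
    ext u
    have hsum : ∑ i, S i j * act S⁻¹ (u - m) i = (u - m) j := by
      have hact : act S (act S⁻¹ (u - m)) = u - m := by
        rw [act_act, Matrix.mul_nonsing_inv S hu, act_one]
      rw [← congrArg (fun x : Space d => x j) hact]
      refine Finset.sum_congr rfl fun i _ => ?_
      -- The sum runs over the row index of `S`, so symmetry is needed to read it as a matrix-vector
      -- product.
      rw [show S i j = S j i by simpa using hS.isHermitian.apply j i]
    simp only [← mul_assoc, ← Finset.sum_mul, hsum]
  · intro i _
    exact Continuous.integrable_of_hasCompactSupport (by fun_prop) hgc.mul_left.mul_left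

/-! ### Stationarity for a preconditioner proportional to the covariance -/

section Proportional

variable {m : Space d} {S : Matrix (Fin d) (Fin d) ℝ} {κ β c : ℝ} {C : Precond d}

/-- With bandwidth `s = κ * c / β`, the displacement from the attractor is `(β + 1) / (s⁻¹ + β + 1)`
times `u - m`; the prefactor `γ / κ` rescales it to exactly `c`. -/
lemma attractor_of_precond_eq (hS : S.PosDef) (hκ : 0 < κ) (hβ : 0 < β) (hc : 0 < c)
    (hC : C (multivariateGaussian m S) = fun _ => c • S) (u : Space d) :
    ((κ * c + β / (β + 1)) / κ) •
      (u - attractor (gaussHat m S) C κ β (multivariateGaussian m S) u) = c • (u - m) := by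
  have hs : 0 < κ / β * c := by positivity
  obtain ⟨K, hK, hw⟩ := locWeight_mul_gaussHat hS m u hβ.le hs
  have ht : 0 < (κ / β * c)⁻¹ + β + 1 := by positivity
  rw [attractor, locMean, hC, smul_smul, wmean_of_reweight hS (hS.smul (inv_pos.2 ht)) hK hw]
  have h1 : u - (m + ((κ / β * c)⁻¹ / ((κ / β * c)⁻¹ + β + 1)) • (u - m)) =
      (1 - (κ / β * c)⁻¹ / ((κ / β * c)⁻¹ + β + 1)) • (u - m) := by module
  rw [h1, smul_smul]
  congr 1
  have h2 : β + κ * c * (β + 1) ≠ 0 := by positivity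
  field_simp
  ring

lemma wellDefined_of_precond_eq (hS : S.PosDef) (hκ : 0 < κ) (hβ : 0 < β) (hc : 0 < c)
    (hC : C (multivariateGaussian m S) = fun _ => c • S) :
    WellDefined (gaussHat m S) C κ β (multivariateGaussian m S) := by
  have hs : 0 < κ / β * c := by positivity
  have ht : 0 < (κ / β * c)⁻¹ + β + 1 := by positivity
  have key : ∀ u, 0 < ∫ v, locWeight (gaussHat m S) β ((κ / β) • c • S) u v
        ∂(multivariateGaussian m S) ∧
      Integrable (locWeight (gaussHat m S) β ((κ / β) • c • S) u) (multivariateGaussian m S) ∧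
      Integrable (fun v => locWeight (gaussHat m S) β ((κ / β) • c • S) u v • v)
        (multivariateGaussian m S) := by
    intro u
    obtain ⟨K, hK, hw⟩ := locWeight_mul_gaussHat hS m u hβ.le hs
    rw [smul_smul]
    exact integral_weight_of_reweight hS (hS.smul (inv_pos.2 ht)) hK hw
  constructor
  · intro u; rw [hC]; exact hS.smul hc
  · intro i j; rw [hC]; exact differentiable_const _
  · intro u; rw [hC]; exact (key u).2.1
  · intro u; rw [hC]; exact (key u).1
  · intro u; rw [hC]; exact (key u).2.2

/-- The preconditioner is constant in space, so its divergence drops out, and `σ σᵀ = 2 c S`. -/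
lemma generator_of_precond_eq (hS : S.PosDef) (hκ : 0 < κ) (hβ : 0 < β) (hc : 0 < c)
    (hC : C (multivariateGaussian m S) = fun _ => c • S) (φ : Space d → ℝ) (u : Space d) :
    generator (gaussHat m S) C κ β (κ * c + β / (β + 1)) (multivariateGaussian m S) φ u =
      c * ouGenerator m S φ u := by
  have hpos : ((2 : ℝ) • c • S).PosSemidef := ((hS.smul hc).smul two_pos).posSemidef
  have hdiff : diffusion C (multivariateGaussian m S) u *
      (diffusion C (multivariateGaussian m S) u).transpose = (2 : ℝ) • c • S := by
    have hT : (CFC.sqrt ((2 : ℝ) • c • S)).transpose = CFC.sqrt ((2 : ℝ) • c • S) := by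
      have h : (CFC.sqrt ((2 : ℝ) • c • S)).IsHermitian := (CFC.sqrt_nonneg _).isSelfAdjoint
      simpa [Matrix.IsHermitian] using h
    rw [diffusion, hC, hT]
    exact CFC.sqrt_mul_sqrt_self _ hpos.nonneg
  have hmdiv : mdiv (C (multivariateGaussian m S)) u = 0 := by
    ext i
    simp [mdiv, hC, pderiv]
  have hdrift : drift (gaussHat m S) C κ β (κ * c + β / (β + 1)) (multivariateGaussian m S) u =
      -(c • (u - m)) := by
    rw [drift, attractor_of_precond_eq hS hκ hβ hc hC, hmdiv, add_zero]
  rw [generator, hdiff, hdrift, ouGenerator, Finset.sum_sub_distrib, mul_sub,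
    sub_eq_add_neg (c * _) (c * _), add_comm, Finset.sum_comm (γ := Fin d), Finset.mul_sum,
    Finset.mul_sum, Finset.mul_sum, ← Finset.sum_neg_distrib]
  congr 1
  · refine Finset.sum_congr rfl fun j _ => ?_
    rw [Finset.mul_sum, Finset.mul_sum]
    refine Finset.sum_congr rfl fun i _ => ?_
    simp only [Matrix.smul_apply, smul_eq_mul]
    ring
  · refine Finset.sum_congr rfl fun j _ => ?_
    simp only [PiLp.neg_apply, PiLp.smul_apply, smul_eq_mul]
    ring

/-- The flux vanishes pointwise, not merely its divergence: `c S ∇p = -c p (u - m)` balances the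
attraction. -/
lemma flux_of_precond_eq (hS : S.PosDef) (hκ : 0 < κ) (hβ : 0 < β) (hc : 0 < c)
    (hC : C (multivariateGaussian m S) = fun _ => c • S) (Z : ℝ) (u : Space d) :
    flux (gaussHat m S) C κ β (κ * c + β / (β + 1)) (multivariateGaussian m S)
      (fun v => Z * gaussHat m S v) u = 0 := by
  have hu : IsUnit S.det := hS.det_pos.ne'.isUnit
  have hgrad : gradient (fun v => Z * gaussHat m S v) u =
      -(Z * gaussHat m S u) • act S⁻¹ (u - m) := by
    apply HasGradientAt.gradient
    have h := ((hasGradientAt_gaussHat hS m u).hasFDerivAt.const_mul Z)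
    rw [hasGradientAt_iff_hasFDerivAt]
    refine h.congr_fderiv ?_
    ext v
    simp only [smul_apply, InnerProductSpace.toDual_apply_apply, inner_smul_left, smul_eq_mul,
      conj_trivial]
    ring
  rw [flux, mul_comm (_ / κ), mul_smul, attractor_of_precond_eq hS hκ hβ hc hC, hgrad, hC,
    smul_act, act_smul, act_act, Matrix.mul_nonsing_inv S hu, act_one]
  module

lemma isStationary_of_precond_eq (hS : S.PosDef) (hκ : 0 < κ) (hβ : 0 < β) (hc : 0 < c)
    (hC : C (multivariateGaussian m S) = fun _ => c • S) :
    IsStationary (gaussHat m S) C κ β (κ * c + β / (β + 1)) (multivariateGaussian m S) := by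
  have hwd := wellDefined_of_precond_eq hS hκ hβ hc hC
  have hgen : ∀ φ : Space d → ℝ, generator (gaussHat m S) C κ β (κ * c + β / (β + 1))
      (multivariateGaussian m S) φ = fun u => c * ouGenerator m S φ u :=
    fun φ => funext (generator_of_precond_eq hS hκ hβ hc hC φ)
  constructor
  · refine ⟨fun _ _ => inferInstance, fun _ _ => hwd, fun φ hφ hφc t _ => ?_,
      fun φ _ _ t _ => intervalIntegrable_const, fun φ hφ hφc t _ => ?_⟩
    · rw [hgen]
      exact (integrable_ouGenerator m S hφ hφc _).2.2.const_mul c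
    · simp [hgen, integral_const_mul, integral_ouGenerator_multivariateGaussian hS m hφ hφc]
  · obtain ⟨Z, hZ, hmS⟩ := multivariateGaussian_eq_lawOf m hS
    refine ⟨fun u => Z * gaussHat m S u, hmS, ?_⟩
    have hflux : flux (gaussHat m S) C κ β (κ * c + β / (β + 1)) (multivariateGaussian m S)
        (fun v => Z * gaussHat m S v) = fun _ => 0 :=
      funext (flux_of_precond_eq hS hκ hβ hc hC Z)
    constructor
    · exact fun _ _ u => (mul_pos hZ (gaussHat_pos m S u)).le
    · intro _ _; rw [← hmS]; infer_instance
    · intro _ _; rw [← hmS]; exact hwd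
    · exact fun _ _ u => (hasGradientAt_gaussHat hS m u).differentiableAt.const_mul Z
    · intro _ _; rw [← hmS, hflux]; exact differentiable_const _
    · intro t _ u
      rw [← hmS, hflux]
      have h0 : vdiv (fun _ : Space d => (0 : Space d)) u = 0 := by simp [vdiv, pderiv]
      rw [h0]
      exact hasDerivWithinAt_const t _ _

end Proportional

lemma precCov_multivariateGaussian (m : Space d) {S : Matrix (Fin d) (Fin d) ℝ}
    (hS : S.PosDef) : precCov (multivariateGaussian m S) = fun _ => (1 : ℝ) • S := by
  funext u
  rw [precCov, cov_multivariateGaussian m hS, one_smul]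

lemma precWeighted_multivariateGaussian (m : Space d) {S : Matrix (Fin d) (Fin d) ℝ}
    (hS : S.PosDef) {α : ℝ} (hα : 0 ≤ α) :
    precWeighted (gaussHat m S) α (multivariateGaussian m S) = fun _ => (α + 1)⁻¹ • S := by
  funext u
  exact wcov_of_reweight hS (hS.smul (by positivity)) one_pos (weight_mul_gaussHat hS m hα)

/-- Localization at `u` moves the mean of the reweighted Gaussian but not its covariance, so even
this preconditioner is constant in space. -/
lemma precLocal_multivariateGaussian (m : Space d) {S : Matrix (Fin d) (Fin d) ℝ}
    (hS : S.PosDef) {α lam : ℝ} (hα : 0 ≤ α) (hlam : 0 < lam) :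
    precLocal (gaussHat m S) α lam (multivariateGaussian m S) =
      fun _ => (lam⁻¹ + α + 1)⁻¹ • S := by
  funext u
  obtain ⟨K, hK, hw⟩ := locWeight_mul_gaussHat hS m u hα hlam
  rw [precLocal, cov_multivariateGaussian m hS]
  exact wcov_of_reweight hS (hS.smul (by positivity)) hK hw

end LCBS

theorem mainTheorem2 (d : ℕ) (m : EuclideanSpace ℝ (Fin d)) (S : Matrix (Fin d) (Fin d) ℝ)
    (hS : S.PosDef) (κ β : ℝ) (hκ : 0 < κ) (hβ : 0 < β) :
    LCBS.IsStationary (LCBS.gaussHat m S) LCBS.precCov κ β (κ + β / (β + 1))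
      (ProbabilityTheory.multivariateGaussian m S) ∧
    (∀ α : ℝ, 0 ≤ α →
      LCBS.IsStationary (LCBS.gaussHat m S) (LCBS.precWeighted (LCBS.gaussHat m S) α)
        κ β (κ / (α + 1) + β / (β + 1))
        (ProbabilityTheory.multivariateGaussian m S)) ∧
    (∀ α lam : ℝ, 0 ≤ α → 0 < lam →
      LCBS.IsStationary (LCBS.gaussHat m S) (LCBS.precLocal (LCBS.gaussHat m S) α lam)
        κ β (κ / (1 / lam + α + 1) + β / (β + 1))
        (ProbabilityTheory.multivariateGaussian m S)) := by
  refine ⟨?_, fun α hα => ?_, fun α lam hα hlam => ?_⟩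
  · have h := LCBS.isStationary_of_precond_eq hS hκ hβ one_pos
      (LCBS.precCov_multivariateGaussian m hS)
    rwa [mul_one] at h
  -- Here `c = (α + 1)⁻¹`, and `κ / (α + 1)` is `κ * c` by definition of division.
  · exact LCBS.isStationary_of_precond_eq hS hκ hβ (by positivity)
      (LCBS.precWeighted_multivariateGaussian m hS hα)
  · rw [one_div]
    exact LCBS.isStationary_of_precond_eq hS hκ hβ (by positivity)
      (LCBS.precLocal_multivariateGaussian m hS hα hlam)
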